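/- For $d\in\mathbb N$ let $M_d$ be the space of complex $d\times d$ matrices, and identify $M_k\otimes M_d$ with the $k\times k$ block matrices with blocks in $M_d$. A matrix $X\in M_{d_1}\otimes M_{d_2}$ is called separable if $X=\sum_{i=1}^n A_i\otimes B_i$ for some $n$ and positive semidefinite $A_i\in M_{d_1}$, $B_i\in M_{d_2}$. A linear map $\Phi:M_{d_1}\to M_{d_2}$ is called $k$-positive if $\mathrm{id}_k\otimes\Phi$ maps positive semidefinite matrices in $M_k\otimes M_{d_1}$ to positive semidefinite matrices; completely positive (CP) if it is $k$-positive for every $k\ge 1$; $k$-PPT if both $\Phi$ and $\mathsf T\circ\Phi$ are $k$-positive, where $\mathsf T$ is the transpose map; and $k$-entanglement breaking ($k$-EB) if it is $k$-positive and $(\mathrm{id}_k\otimes\Phi)(X)$ is separable for every positive semidefinite $X\in M_k\otimes M_{d_1}$. For $\lambda\in\mathbb R$ let $\mathcal W_\lambda:M_d\to M_d$ be the Holevo–Werner map $\mathcal W_\lambda(X)=\operatorname{tr}(X)I-\lambda X^{\mathsf T}$. Let $1\le k\le d$ and $\lambda\in\mathbb R$, and consider the conditions (i) $\mathcal W_\lambda$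 is completely positive and $k$-entanglement breaking; (ii) $\mathcal W_\lambda$ is a $k$-PPT map; (iii) $\lambda\in[-1,1/k]$. If $k\ge 2$, then (i), (ii) and (iii) are equivalent. If $k=1$ and $d\ge 2$, then (i) and (iii) are still equivalent. The implications (iii) $\Rightarrow$ (i) $\Rightarrow$ (ii) hold for all $1\le k\le d$. -/

import Mathlib

open scoped ComplexOrder Kronecker

/-- The map `id_k ⊗ Φ : M_k ⊗ M_{d₁} → M_k ⊗ M_{d₂}`, where `M_k ⊗ M_d` is identified with the
`k × k` block matrices with blocks in `M_d`: it applies `Φ` to each block. -/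
def idTensor (k : ℕ) {d₁ d₂ : ℕ}
    (Φ : Matrix (Fin d₁) (Fin d₁) ℂ →ₗ[ℂ] Matrix (Fin d₂) (Fin d₂) ℂ) :
    Matrix (Fin k × Fin d₁) (Fin k × Fin d₁) ℂ →ₗ[ℂ]
      Matrix (Fin k × Fin d₂) (Fin k × Fin d₂) ℂ where
  toFun X := Matrix.of fun p q =>
    Φ (Matrix.of fun a b => X (p.1, a) (q.1, b)) p.2 q.2
  map_add' X Y := by
    ext p q
    exact congrFun (congrFun (Φ.map_add (Matrix.of fun a b => X (p.1, a) (q.1, b))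
      (Matrix.of fun a b => Y (p.1, a) (q.1, b))) p.2) q.2
  map_smul' c X := by
    ext p q
    exact congrFun (congrFun (Φ.map_smul c (Matrix.of fun a b => X (p.1, a) (q.1, b))) p.2) q.2

/-- `id_k ⊗ Φ` acts on elementary tensors as it should. -/
theorem idTensor_kronecker (k : ℕ) {d₁ d₂ : ℕ}
    (Φ : Matrix (Fin d₁) (Fin d₁) ℂ →ₗ[ℂ] Matrix (Fin d₂) (Fin d₂) ℂ)
    (A : Matrix (Fin k) (Fin k) ℂ) (B : Matrix (Fin d₁) (Fin d₁) ℂ) :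
    idTensor k Φ (A ⊗ₖ B) = A ⊗ₖ Φ B := by
  ext p q
  exact congrFun (congrFun (Φ.map_smul (A p.1 q.1) B) p.2) q.2

/-- A matrix in `M_{d₁} ⊗ M_{d₂}` is separable if it is a finite sum of tensor products of
positive semidefinite matrices. -/
def IsSeparableMatrix {d₁ d₂ : ℕ} (X : Matrix (Fin d₁ × Fin d₂) (Fin d₁ × Fin d₂) ℂ) : Prop :=
  ∃ (n : ℕ) (A : Fin n → Matrix (Fin d₁) (Fin d₁) ℂ) (B : Fin n → Matrix (Fin d₂) (Fin d₂) ℂ),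
    (∀ i, (A i).PosSemidef) ∧ (∀ i, (B i).PosSemidef) ∧ X = ∑ i, A i ⊗ₖ B i

/-- `Φ` is `k`-positive: `id_k ⊗ Φ` preserves positive semidefiniteness. -/
def IsKPositive (k : ℕ) {d₁ d₂ : ℕ}
    (Φ : Matrix (Fin d₁) (Fin d₁) ℂ →ₗ[ℂ] Matrix (Fin d₂) (Fin d₂) ℂ) : Prop :=
  ∀ X : Matrix (Fin k × Fin d₁) (Fin k × Fin d₁) ℂ,
    X.PosSemidef → (idTensor k Φ X).PosSemidef

/-- `Φ` is completely positive: it is `k`-positive for every `k ≥ 1`. -/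
def IsCPMap {d₁ d₂ : ℕ}
    (Φ : Matrix (Fin d₁) (Fin d₁) ℂ →ₗ[ℂ] Matrix (Fin d₂) (Fin d₂) ℂ) : Prop :=
  ∀ k : ℕ, 1 ≤ k → IsKPositive k Φ

/-- The transpose map on `M_d`. -/
def transposeMap (d : ℕ) : Matrix (Fin d) (Fin d) ℂ →ₗ[ℂ] Matrix (Fin d) (Fin d) ℂ :=
  (Matrix.transposeLinearEquiv (Fin d) (Fin d) ℂ ℂ).toLinearMap

/-- `Φ` is a `k`-PPT map: both `Φ` and `T ∘ Φ` are `k`-positive, `T` being the transpose map. -/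
def IsKPPT (k : ℕ) {d₁ d₂ : ℕ}
    (Φ : Matrix (Fin d₁) (Fin d₁) ℂ →ₗ[ℂ] Matrix (Fin d₂) (Fin d₂) ℂ) : Prop :=
  IsKPositive k Φ ∧ IsKPositive k (transposeMap d₂ ∘ₗ Φ)

/-- `Φ` is `k`-entanglement breaking: it is `k`-positive, and `(id_k ⊗ Φ)(X)` is separable for
every positive semidefinite `X` in `M_k ⊗ M_{d₁}`. -/
def IsKEB (k : ℕ) {d₁ d₂ : ℕ}
    (Φ : Matrix (Fin d₁) (Fin d₁) ℂ →ₗ[ℂ] Matrix (Fin d₂) (Fin d₂) ℂ) : Prop :=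
  IsKPositive k Φ ∧
    ∀ X : Matrix (Fin k × Fin d₁) (Fin k × Fin d₁) ℂ,
      X.PosSemidef → IsSeparableMatrix (idTensor k Φ X)

/-- The Holevo–Werner map `W_λ(X) = tr(X) I - λ Xᵀ` on `M_d`. -/
def holevoWerner (d : ℕ) (lam : ℝ) :
    Matrix (Fin d) (Fin d) ℂ →ₗ[ℂ] Matrix (Fin d) (Fin d) ℂ where
  toFun X := X.trace • (1 : Matrix (Fin d) (Fin d) ℂ) - (lam : ℂ) • X.transpose
  map_add' X Y := by
    simp only [Matrix.trace_add, Matrix.transpose_add]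
    module
  map_smul' c X := by
    simp only [Matrix.trace_smul, Matrix.transpose_smul, smul_eq_mul, RingHom.id_apply]
    module

open Matrix

/-! `W_λ` is affine in `λ`, so (iii) ⇒ (i) reduces to endpoints, and to rank-one inputs `ψψ*`.
Averaging projections onto product vectors over phases gives separable matrices with prescribed
cross terms: `phaseAverage` settles `λ = -1`. For `λ = 1/k`, a polar decomposition writes `ψ` as a
sum of at most `k` product terms with orthonormal second factors, and `isSeparableMatrix_pairs`
splits the output into contributions of pairs of terms. Complete positivity also needs the endpoint
`λ = 1`, where the output is a sum of antisymmetrized projections. Conversely, separable matrices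
have positive partial transpose, and maximally entangled inputs detect `λ < -1` through `W_λ` and `λ
> 1/k` through `T ∘ W_λ`. -/

namespace IsSeparableMatrix

/-! ### Separable matrices and phase averages. -/

variable {m d : ℕ}

theorem zero : IsSeparableMatrix (0 : Matrix (Fin m × Fin d) (Fin m × Fin d) ℂ) :=
  ⟨0, Fin.elim0, Fin.elim0, fun i => i.elim0, fun i => i.elim0, by simp⟩

theorem kronecker {A : Matrix (Fin m) (Fin m) ℂ} {B : Matrix (Fin d) (Fin d) ℂ}
    (hA : A.PosSemidef) (hB : B.PosSemidef) : IsSeparableMatrix (A ⊗ₖ B) :=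
  ⟨1, fun _ => A, fun _ => B, fun _ => hA, fun _ => hB, by simp⟩

theorem add {X Y : Matrix (Fin m × Fin d) (Fin m × Fin d) ℂ}
    (hX : IsSeparableMatrix X) (hY : IsSeparableMatrix Y) : IsSeparableMatrix (X + Y) := by
  obtain ⟨n, A, B, hA, hB, rfl⟩ := hX
  obtain ⟨n', A', B', hA', hB', rfl⟩ := hY
  refine ⟨n + n', Fin.append A A', Fin.append B B', fun i => ?_, fun i => ?_, ?_⟩
  · refine Fin.addCases (fun j => ?_) (fun j => ?_) i <;> simp [hA, hA']
  · refine Fin.addCases (fun j => ?_) (fun j => ?_) i <;> simp [hB, hB']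
  · simp [Fin.sum_univ_add]

theorem smul {X : Matrix (Fin m × Fin d) (Fin m × Fin d) ℂ} (hX : IsSeparableMatrix X)
    {c : ℝ} (hc : 0 ≤ c) : IsSeparableMatrix ((c : ℂ) • X) := by
  obtain ⟨n, A, B, hA, hB, rfl⟩ := hX
  refine ⟨n, fun i => (c : ℂ) • A i, B, fun i => (hA i).smul (by exact_mod_cast hc), hB, ?_⟩
  simp [Finset.smul_sum, smul_kronecker]

theorem sum {ι : Type*} (s : Finset ι) {X : ι → Matrix (Fin m × Fin d) (Fin m × Fin d) ℂ}
    (h : ∀ i ∈ s, IsSeparableMatrix (X i)) : IsSeparableMatrix (∑ i ∈ s, X i) :=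
  Finset.sum_induction X IsSeparableMatrix (fun _ _ => add) zero h

theorem posSemidef {X : Matrix (Fin m × Fin d) (Fin m × Fin d) ℂ} (hX : IsSeparableMatrix X) :
    X.PosSemidef := by
  obtain ⟨n, A, B, hA, hB, rfl⟩ := hX
  exact posSemidef_sum _ fun i _ => (hA i).kronecker (hB i)

/-- The projection onto a product vector. -/
theorem productVector (x : Fin m → ℂ) (y : Fin d → ℂ) :
    IsSeparableMatrix (of fun p q : Fin m × Fin d =>
      x p.1 * star (x q.1) * (y p.2 * star (y q.2))) :=
  kronecker (posSemidef_vecMulVec_self_star x) (posSemidef_vecMulVec_self_star y)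

/-- The average over the fourth roots of unity `z` of the projections onto
`(x + z x') ⊗ (y + z y')`, summed over a family of pairs `(x', y')` with independent phases. -/
theorem phaseAverage {ι : Type*} (f : ι → Fin m → ℂ) (e : ι → Fin d → ℂ) (s : Finset ι) :
    ∀ (x : Fin m → ℂ) (y : Fin d → ℂ), IsSeparableMatrix (of fun p q : Fin m × Fin d =>
      x p.1 * star (x q.1) * (y p.2 * star (y q.2))
      + x p.1 * star (x q.1) * (∑ r ∈ s, e r p.2 * star (e r q.2))
      + (∑ r ∈ s, f r p.1 * star (f r q.1)) * (y p.2 * star (y q.2))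
      + x p.1 * star (y q.2) * (∑ r ∈ s, star (f r q.1) * e r p.2)
      + star (x q.1) * y p.2 * (∑ r ∈ s, f r p.1 * star (e r q.2))
      + (∑ r ∈ s, f r p.1 * star (f r q.1)) * (∑ r ∈ s, e r p.2 * star (e r q.2))
      + (∑ r ∈ s, f r p.1 * star (e r q.2)) * (∑ r ∈ s, star (f r q.1) * e r p.2)
      - ∑ r ∈ s, f r p.1 * star (f r q.1) * (e r p.2 * star (e r q.2))) := by
  classical
  induction s using Finset.induction_on with
  | empty =>
    intro x y
    simpa using productVector x y
  | insert t s ht ih =>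
    intro x y
    -- The summands have degree at most 2 in `z` and in its conjugate, so averaging over fourth
    -- roots of unity keeps exactly the terms of equal degree in both.
    have key := (sum Finset.univ (fun (n : Fin 4) _ => ih
      (fun i => x i + Complex.I ^ (n : ℕ) * f t i)
      (fun a => y a + Complex.I ^ (n : ℕ) * e t a))).smul (c := 1 / 4) (by norm_num)
    convert key using 1
    ext p q
    have h2 : Complex.I ^ 2 = -1 := Complex.I_sq
    have h3 : Complex.I ^ 3 = -Complex.I := by rw [pow_succ, h2]; ring
    simp only [Finset.sum_insert ht, Fin.sum_univ_four, Matrix.smul_apply, Matrix.add_apply, of_apply,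
      smul_eq_mul, Fin.val_zero, Fin.val_one, Fin.val_two, show ((3 : Fin 4) : ℕ) = 3 from rfl,
      pow_zero, pow_one, h2, h3, star_add, star_mul',
      Complex.star_def, Complex.conj_I, map_one, map_neg]
    push_cast
    ring_nf
    simp only [h2, Complex.I_pow_four]
    ring

/-- The average over the fourth roots of unity `z` of the projections onto
`(x + z x') ⊗ (y - z y')`. -/
theorem pairAverage (x x' : Fin m → ℂ) (y y' : Fin d → ℂ) :
    IsSeparableMatrix (of fun p q : Fin m × Fin d =>
      (x p.1 * star (x q.1) + x' p.1 * star (x' q.1)) *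
        (y p.2 * star (y q.2) + y' p.2 * star (y' q.2))
      - x p.1 * star (x' q.1) * (y' p.2 * star (y q.2))
      - x' p.1 * star (x q.1) * (y p.2 * star (y' q.2))) := by
  convert phaseAverage (fun _ : Unit => x') (fun _ : Unit => -y') Finset.univ x y using 1
  ext p q
  simp
  ring

end IsSeparableMatrix

theorem sum_sum_ite_eq_zero {ι : Type*} [Fintype ι] [DecidableEq ι] (F : ι → ι → ℂ) :
    (∑ p, ∑ q, if p = q then 0 else F p q) = (∑ p, ∑ q, F p q) - ∑ p, F p p := by
  have h (p q : ι) : (if p = q then 0 else F p q) = F p q - if p = q then F p q else 0 := by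
    split_ifs <;> simp
  simp [h, Finset.sum_sub_distrib]

/-- Each unordered pair `r ≠ t` contributes a `pairAverage`. These supply all cross terms and `k -
1` copies of each diagonal term; the missing diagonal copy comes from the subtracted product itself.
What is left over is separable term by term. -/
theorem isSeparableMatrix_pairs {m k d : ℕ} (g : Fin k → Fin m → ℂ) (u : Fin k → Fin d → ℂ)
    (hk : 1 ≤ k) {R : Matrix (Fin d) (Fin d) ℂ} (hR : R.PosSemidef) :
    IsSeparableMatrix (of fun p q : Fin m × Fin d =>
      (k : ℂ) * ((∑ r, g r p.1 * star (g r q.1)) * (R p.2 q.2 + ∑ r, u r p.2 * star (u r q.2)))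
      - (∑ r, g r p.1 * star (u r q.2)) * (∑ r, star (g r q.1) * u r p.2)) := by
  have h1 : IsSeparableMatrix (∑ r, ∑ t, if r = t then 0 else of fun p q : Fin m × Fin d =>
      (g r p.1 * star (g r q.1) + g t p.1 * star (g t q.1)) *
        (u r p.2 * star (u r q.2) + u t p.2 * star (u t q.2))
      - g r p.1 * star (g t q.1) * (u t p.2 * star (u r q.2))
      - g t p.1 * star (g r q.1) * (u r p.2 * star (u t q.2))) := by
    refine .sum _ fun r _ => .sum _ fun t _ => ?_
    split_ifs
    · exact .zero
    · exact .pairAverage _ _ _ _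
  have h2 : IsSeparableMatrix (∑ r, ∑ t, if r = t then 0 else of fun p q : Fin m × Fin d =>
      g r p.1 * star (g r q.1) * (u t p.2 * star (u t q.2))) := by
    refine .sum _ fun r _ => .sum _ fun t _ => ?_
    split_ifs
    · exact .zero
    · exact .productVector _ _
  have h3 : IsSeparableMatrix (∑ r, vecMulVec (g r) (star (g r)) ⊗ₖ R) :=
    .sum _ fun r _ => .kronecker (posSemidef_vecMulVec_self_star _) hR
  have hk' : (0 : ℝ) ≤ (k : ℝ) - 1 := by
    have : (1 : ℝ) ≤ k := by exact_mod_cast hk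
    linarith
  -- The factor `1 / 2` compensates for summing over ordered pairs.
  convert ((h1.smul (c := 1 / 2) (by norm_num)).add (h2.smul hk')).add
    (h3.smul (c := (k : ℝ)) (by positivity)) using 1
  ext p q
  have happ (r t : Fin k) (F : Matrix (Fin m × Fin d) (Fin m × Fin d) ℂ) :
      (if r = t then 0 else F) p q = if r = t then 0 else F p q := by
    split_ifs <;> rfl
  simp only [Matrix.add_apply, Matrix.smul_apply, Matrix.sum_apply, happ, of_apply, smul_eq_mul, sum_sum_ite_eq_zero,
    kroneckerMap_apply, vecMulVec_apply, Pi.star_apply]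
  have e1 : (∑ r, ∑ t, ((g r p.1 * star (g r q.1) + g t p.1 * star (g t q.1)) *
        (u r p.2 * star (u r q.2) + u t p.2 * star (u t q.2))
      - g r p.1 * star (g t q.1) * (u t p.2 * star (u r q.2))
      - g t p.1 * star (g r q.1) * (u r p.2 * star (u t q.2)))) =
      2 * ((k : ℂ) * ∑ r, g r p.1 * star (g r q.1) * (u r p.2 * star (u r q.2)))
      + 2 * ((∑ r, g r p.1 * star (g r q.1)) * ∑ r, u r p.2 * star (u r q.2))
      - 2 * ((∑ r, g r p.1 * star (u r q.2)) * (∑ r, star (g r q.1) * u r p.2)) := by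
    have a1 : ∑ r : Fin k, ∑ _t : Fin k, g r p.1 * star (g r q.1) * (u r p.2 * star (u r q.2)) =
        (k : ℂ) * ∑ r, g r p.1 * star (g r q.1) * (u r p.2 * star (u r q.2)) := by
      simp [Finset.mul_sum]
    have a2 : ∑ _r : Fin k, ∑ t : Fin k, g t p.1 * star (g t q.1) * (u t p.2 * star (u t q.2)) =
        (k : ℂ) * ∑ r, g r p.1 * star (g r q.1) * (u r p.2 * star (u r q.2)) := by
      simp
    have a3 : ∑ r, ∑ t, g r p.1 * star (g r q.1) * (u t p.2 * star (u t q.2)) =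
        (∑ r, g r p.1 * star (g r q.1)) * ∑ r, u r p.2 * star (u r q.2) := by
      rw [Finset.sum_mul_sum]
    have a4 : ∑ r, ∑ t, g t p.1 * star (g t q.1) * (u r p.2 * star (u r q.2)) =
        (∑ r, g r p.1 * star (g r q.1)) * ∑ r, u r p.2 * star (u r q.2) := by
      rw [Finset.sum_comm, Finset.sum_mul_sum]
    have a5 : ∑ r, ∑ t, g r p.1 * star (g t q.1) * (u t p.2 * star (u r q.2)) =
        (∑ r, g r p.1 * star (u r q.2)) * (∑ r, star (g r q.1) * u r p.2) := by
      rw [Finset.sum_mul_sum]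
      exact Finset.sum_congr rfl fun r _ => Finset.sum_congr rfl fun t _ => by ring
    have a6 : ∑ r, ∑ t, g t p.1 * star (g r q.1) * (u r p.2 * star (u t q.2)) =
        (∑ r, g r p.1 * star (u r q.2)) * (∑ r, star (g r q.1) * u r p.2) := by
      rw [Finset.sum_comm, a5]
    simp only [add_mul, mul_add, Finset.sum_sub_distrib, Finset.sum_add_distrib, a1, a2, a3, a4,
      a5, a6]
    ring
  have e2 : (∑ r, ((g r p.1 * star (g r q.1) + g r p.1 * star (g r q.1)) *
        (u r p.2 * star (u r q.2) + u r p.2 * star (u r q.2))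
      - g r p.1 * star (g r q.1) * (u r p.2 * star (u r q.2))
      - g r p.1 * star (g r q.1) * (u r p.2 * star (u r q.2)))) =
      2 * ∑ r, g r p.1 * star (g r q.1) * (u r p.2 * star (u r q.2)) := by
    rw [Finset.mul_sum]
    exact Finset.sum_congr rfl fun r _ => by ring
  rw [e1, e2, ← Finset.sum_mul, ← Finset.sum_mul_sum]
  push_cast
  ring

/-! ### Polar decomposition. -/

/-- A matrix factors as `g * n` with `n` a partial isometry and `g` supported on its range. -/
theorem exists_eq_mul_partialIsometry {m d : ℕ} (M : Matrix (Fin m) (Fin d) ℂ) :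
    ∃ (g : Matrix (Fin m) (Fin m) ℂ) (n : Matrix (Fin m) (Fin d) ℂ),
      M = g * n ∧ g * (n * nᴴ) = g ∧ n * nᴴ * n = n := by
  have hA : (M * Mᴴ).PosSemidef := posSemidef_self_mul_conjTranspose M
  set U : Matrix (Fin m) (Fin m) ℂ := (hA.1.eigenvectorUnitary : Matrix (Fin m) (Fin m) ℂ) with hU
  set μ := hA.1.eigenvalues
  have hUU : U * Uᴴ = 1 := Unitary.mul_star_self_of_mem hA.1.eigenvectorUnitary.2
  have hUU' : Uᴴ * U = 1 := Unitary.star_mul_self_of_mem hA.1.eigenvectorUnitary.2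
  have hspec : M * Mᴴ = U * diagonal (fun i => (μ i : ℂ)) * Uᴴ := hA.1.spectral_theorem
  -- In an eigenbasis of `M * Mᴴ` the rows of `M` become orthogonal, with squared norms `μ i`.
  -- Normalizing them gives `n`; the convention `0⁻¹ = 0` leaves zero rows at zero.
  set N := Uᴴ * M with hN
  have hNN : N * Nᴴ = diagonal (fun i => (μ i : ℂ)) := by
    calc N * Nᴴ = Uᴴ * (M * Mᴴ) * U := by
          simp [hN, conjTranspose_mul, Matrix.mul_assoc]
      _ = (Uᴴ * U) * diagonal (fun i => (μ i : ℂ)) * (Uᴴ * U) := by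
          rw [hspec]; simp only [Matrix.mul_assoc]
      _ = _ := by simp [hUU']
  have hμ (i) : 0 ≤ μ i := hA.eigenvalues_nonneg i
  set s : Fin m → ℂ := fun i => ((√(μ i) : ℝ) : ℂ) with hs
  have hss (i) : s i * s i = μ i := by
    simp only [hs]; rw [← Complex.ofReal_mul, Real.mul_self_sqrt (hμ i)]
  have hconj : (diagonal (s⁻¹))ᴴ = diagonal (s⁻¹) := by
    rw [diagonal_conjTranspose]; congr 1; ext i; simp [hs]
  have hrow (i a) (h : s i = 0) : N i a = 0 := by
    have h0 : (N * Nᴴ) i i = 0 := by rw [hNN]; simp [← hss, h]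
    rw [Matrix.mul_apply] at h0
    have h1 : ∑ c, Complex.normSq (N i c) = 0 := by
      have : (∑ c, ((Complex.normSq (N i c) : ℝ) : ℂ)) = 0 := by
        rw [← h0]
        exact Finset.sum_congr rfl fun c _ => by
          simp [conjTranspose_apply, Complex.mul_conj]
      exact_mod_cast this
    have h2 := (Finset.sum_eq_zero_iff_of_nonneg (fun c _ => Complex.normSq_nonneg _)).1 h1 a
      (Finset.mem_univ a)
    exact Complex.normSq_eq_zero.1 h2
  have hsN : diagonal s * (diagonal s⁻¹ * N) = N := by
    ext i a
    rw [diagonal_mul, diagonal_mul, Pi.inv_apply]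
    by_cases h : s i = 0
    · simp [h, hrow i a h]
    · field_simp
  have hnn : (diagonal s⁻¹ * N) * (diagonal s⁻¹ * N)ᴴ = diagonal (fun i => (s i)⁻¹ * s i) := by
    calc (diagonal s⁻¹ * N) * (diagonal s⁻¹ * N)ᴴ
        = diagonal s⁻¹ * (N * Nᴴ) * diagonal s⁻¹ := by
          rw [conjTranspose_mul, hconj]; simp only [Matrix.mul_assoc]
      _ = _ := by
          rw [hNN, diagonal_mul_diagonal, diagonal_mul_diagonal]
          congr 1; ext i
          rw [← hss, Pi.inv_apply]
          by_cases h : s i = 0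
          · simp [h]
          · field_simp
  refine ⟨U * diagonal s, diagonal s⁻¹ * N, ?_, ?_, ?_⟩
  · rw [Matrix.mul_assoc, hsN, hN, ← Matrix.mul_assoc, hUU, Matrix.one_mul]
  · rw [hnn, Matrix.mul_assoc, diagonal_mul_diagonal]
    congr 2; ext i
    by_cases h : s i = 0
    · simp [h]
    · field_simp
  · rw [hnn, ← Matrix.mul_assoc, diagonal_mul_diagonal]
    congr 2; ext i
    by_cases h : s i = 0
    · simp [h]
    · simp [h]

/-! ### Separability and complete positivity of the outputs. -/

theorem idTensor_holevoWerner_apply {m d : ℕ} (lam : ℝ)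
    (X : Matrix (Fin m × Fin d) (Fin m × Fin d) ℂ) (p q : Fin m × Fin d) :
    idTensor m (holevoWerner d lam) X p q =
      (∑ c, X (p.1, c) (q.1, c)) * (1 : Matrix (Fin d) (Fin d) ℂ) p.2 q.2
        - lam * X (p.1, q.2) (q.1, p.2) := by
  simp [idTensor, holevoWerner, Matrix.trace]

/-- The convex-combination identity for `id ⊗ W_λ` as a function of `λ`. -/
theorem idTensor_holevoWerner_convex {m d : ℕ} {a b s t : ℝ} (h : s + t = 1)
    (X : Matrix (Fin m × Fin d) (Fin m × Fin d) ℂ) :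
    idTensor m (holevoWerner d (s * a + t * b)) X =
      (s : ℂ) • idTensor m (holevoWerner d a) X + (t : ℂ) • idTensor m (holevoWerner d b) X := by
  ext p q
  obtain rfl : s = 1 - t := by linarith
  simp only [Matrix.add_apply, Matrix.smul_apply, idTensor_holevoWerner_apply, smul_eq_mul]
  push_cast
  ring

theorem isSeparableMatrix_idTensor_of_rankOne {m d₁ d₂ : ℕ}
    {Φ : Matrix (Fin d₁) (Fin d₁) ℂ →ₗ[ℂ] Matrix (Fin d₂) (Fin d₂) ℂ}
    (h : ∀ ψ : Fin m × Fin d₁ → ℂ, IsSeparableMatrix (idTensor m Φ (vecMulVec ψ (star ψ))))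
    {X : Matrix (Fin m × Fin d₁) (Fin m × Fin d₁) ℂ} (hX : X.PosSemidef) :
    IsSeparableMatrix (idTensor m Φ X) := by
  obtain ⟨n, v, rfl⟩ := posSemidef_iff_eq_sum_vecMulVec.1 hX
  rw [map_sum]
  exact .sum _ fun i _ => h _

theorem isKPositive_of_rankOne {m d₁ d₂ : ℕ}
    {Φ : Matrix (Fin d₁) (Fin d₁) ℂ →ₗ[ℂ] Matrix (Fin d₂) (Fin d₂) ℂ}
    (h : ∀ ψ : Fin m × Fin d₁ → ℂ, (idTensor m Φ (vecMulVec ψ (star ψ))).PosSemidef) :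
    IsKPositive m Φ := by
  intro X hX
  obtain ⟨n, v, rfl⟩ := posSemidef_iff_eq_sum_vecMulVec.1 hX
  rw [map_sum]
  exact posSemidef_sum _ fun i _ => h _

theorem isSeparableMatrix_holevoWerner_neg_one {m d : ℕ}
    {X : Matrix (Fin m × Fin d) (Fin m × Fin d) ℂ} (hX : X.PosSemidef) :
    IsSeparableMatrix (idTensor m (holevoWerner d (-1)) X) := by
  refine isSeparableMatrix_idTensor_of_rankOne (fun ψ => ?_) hX
  -- With `x = y = 0` only the last three terms of `phaseAverage` survive; the product vectors added
  -- here cancel the subtracted diagonal.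
  convert (IsSeparableMatrix.phaseAverage (fun r i => ψ (i, r)) (fun r : Fin d => Pi.single r 1)
    Finset.univ 0 0).add (.sum Finset.univ fun r _ => .productVector (fun i => ψ (i, r))
      (Pi.single r (1 : ℂ))) using 1
  ext p q
  have h1 (a : Fin d) (F : Fin d → ℂ) : ∑ r, F r * (Pi.single r (1 : ℂ) : Fin d → ℂ) a = F a := by
    simp [Pi.single_apply]
  have h2 (a : Fin d) (F : Fin d → ℂ) :
      ∑ r, F r * star ((Pi.single r (1 : ℂ) : Fin d → ℂ) a) = F a := by
    simp [Pi.single_apply, apply_ite]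
  rw [idTensor_holevoWerner_apply]
  simp only [Matrix.add_apply, of_apply, Matrix.sum_apply, h1, h2, vecMulVec_apply, Pi.star_apply, Pi.zero_apply,
    zero_mul, mul_zero, star_zero, zero_add]
  have h3 : (Pi.single q.2 (1 : ℂ) : Fin d → ℂ) p.2 = (1 : Matrix (Fin d) (Fin d) ℂ) p.2 q.2 := by
    rw [one_apply, Pi.single_apply]
  rw [h3]
  push_cast
  ring

theorem isSeparableMatrix_holevoWerner_inv {k d : ℕ} (hk : 1 ≤ k)
    {X : Matrix (Fin k × Fin d) (Fin k × Fin d) ℂ} (hX : X.PosSemidef) :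
    IsSeparableMatrix (idTensor k (holevoWerner d (1 / k)) X) := by
  refine isSeparableMatrix_idTensor_of_rankOne (fun ψ => ?_) hX
  obtain ⟨g, n, hM, hg, hn⟩ := exists_eq_mul_partialIsometry (of fun i a => ψ (i, a))
  have hQ : (nᴴ * n) * (nᴴ * n) = nᴴ * n := by
    rw [Matrix.mul_assoc, ← Matrix.mul_assoc n, hn]
  have hR : (1 - nᴴ * n).PosSemidef := by
    have h := posSemidef_conjTranspose_mul_self (1 - nᴴ * n)
    have : (1 - nᴴ * n)ᴴ * (1 - nᴴ * n) = 1 - nᴴ * n := by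
      simp only [conjTranspose_sub, conjTranspose_one, conjTranspose_mul,
        conjTranspose_conjTranspose, sub_mul, mul_sub, one_mul, mul_one, hQ]
      simp
    rwa [this] at h
  -- The transpose in `W_λ` forces the conjugate of `n`. The projection `1 - nᴴ * n` completes the
  -- sum over `u` to the identity.
  convert (isSeparableMatrix_pairs (fun r i => g i r) (fun r a => star (n r a)) hk hR).smul
    (c := 1 / k) (by positivity) using 1
  ext p q
  have hψ (i a) : ψ (i, a) = ∑ r, g i r * n r a := by
    rw [← Matrix.mul_apply, ← hM]; rfl
  have hψ' (i a) : star (ψ (i, a)) = ∑ r, star (g i r) * star (n r a) := by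
    simp [hψ]
  have htr (i j) : ∑ c, ψ (i, c) * star (ψ (j, c)) = ∑ r, g i r * star (g j r) := by
    have : (g * n) * (g * n)ᴴ = g * gᴴ := by
      rw [conjTranspose_mul, ← Matrix.mul_assoc, Matrix.mul_assoc g, hg]
    have h := congrFun (congrFun this i) j
    rw [← hM] at h
    simpa [Matrix.mul_apply] using h
  have hone : (1 - nᴴ * n : Matrix (Fin d) (Fin d) ℂ) p.2 q.2 + ∑ r, star (n r p.2) * star (star (n r q.2)) =
      (1 : Matrix (Fin d) (Fin d) ℂ) p.2 q.2 := by
    simp [Matrix.mul_apply]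
  have hk0 : (k : ℂ) ≠ 0 := by exact_mod_cast (by omega : k ≠ 0)
  rw [idTensor_holevoWerner_apply]
  simp only [Matrix.smul_apply, of_apply, hone, vecMulVec_apply, Pi.star_apply, htr, smul_eq_mul]
  simp only [star_star, ← hψ, ← hψ']
  push_cast
  field_simp

/-- With `ψ_c` the slices of `ψ`, the output is half the sum of the projections onto `ψ_e ⊗ e_c -
ψ_c ⊗ e_e`. -/
theorem isKPositive_holevoWerner_one (m d : ℕ) : IsKPositive m (holevoWerner d 1) := by
  refine isKPositive_of_rankOne fun ψ => ?_
  have h : (((1 / 2 : ℝ) : ℂ) • ∑ c : Fin d, ∑ e : Fin d, vecMulVec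
      (fun p : Fin m × Fin d => (1 : Matrix (Fin d) (Fin d) ℂ) p.2 c * ψ (p.1, e)
        - (1 : Matrix (Fin d) (Fin d) ℂ) p.2 e * ψ (p.1, c))
      (star fun p : Fin m × Fin d => (1 : Matrix (Fin d) (Fin d) ℂ) p.2 c * ψ (p.1, e)
        - (1 : Matrix (Fin d) (Fin d) ℂ) p.2 e * ψ (p.1, c))).PosSemidef :=
    (posSemidef_sum _ fun c _ => posSemidef_sum _ fun e _ =>
      posSemidef_vecMulVec_self_star _).smul (by exact_mod_cast (by norm_num : (0:ℝ) ≤ 1 / 2))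
  convert h using 1
  ext p q
  rw [idTensor_holevoWerner_apply]
  simp only [Matrix.smul_apply, Matrix.sum_apply, vecMulVec_apply, Pi.star_apply, smul_eq_mul, star_sub,
    star_mul', one_apply, apply_ite star, star_one, star_zero]
  simp only [sub_mul, mul_sub, Finset.sum_sub_distrib, ite_mul, mul_ite, one_mul, zero_mul,
    mul_zero, mul_one, Finset.sum_ite_eq, Finset.mem_univ, if_true]
  by_cases hpq : p.2 = q.2
  · simp [hpq]
    ring
  · simp [hpq]
    ring

theorem isSeparableMatrix_holevoWerner {k d : ℕ} (hk : 1 ≤ k) {lam : ℝ}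
    (hl : lam ∈ Set.Icc (-1 : ℝ) (1 / k)) {X : Matrix (Fin k × Fin d) (Fin k × Fin d) ℂ}
    (hX : X.PosSemidef) : IsSeparableMatrix (idTensor k (holevoWerner d lam) X) := by
  have hk0 : (0 : ℝ) < 1 / k := by positivity
  obtain ⟨s, t, hs, ht, hst, rfl⟩ := (Convex.mem_Icc (by linarith)).1 hl
  rw [idTensor_holevoWerner_convex hst]
  exact ((isSeparableMatrix_holevoWerner_neg_one hX).smul hs).add
    ((isSeparableMatrix_holevoWerner_inv hk hX).smul ht)

theorem isCPMap_holevoWerner {d : ℕ} {lam : ℝ} (hl : lam ∈ Set.Icc (-1 : ℝ) 1) :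
    IsCPMap (holevoWerner d lam) := by
  intro m _ X hX
  obtain ⟨s, t, hs, ht, hst, rfl⟩ := (Convex.mem_Icc (by norm_num)).1 hl
  rw [idTensor_holevoWerner_convex hst]
  exact ((isSeparableMatrix_holevoWerner_neg_one hX).posSemidef.smul (by exact_mod_cast hs)).add
    ((isKPositive_holevoWerner_one m d X hX).smul (by exact_mod_cast ht))

/-! ### Necessity of the bounds. -/

theorem IsKEB.isKPPT {k d₁ d₂ : ℕ}
    {Φ : Matrix (Fin d₁) (Fin d₁) ℂ →ₗ[ℂ] Matrix (Fin d₂) (Fin d₂) ℂ} (h : IsKEB k Φ) :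
    IsKPPT k Φ := by
  refine ⟨h.1, fun X hX => ?_⟩
  obtain ⟨n, A, B, hA, hB, hAB⟩ := h.2 X hX
  have : idTensor k (transposeMap d₂ ∘ₗ Φ) X = ∑ i, A i ⊗ₖ (B i)ᵀ := by
    ext p q
    have := congrFun (congrFun hAB (p.1, q.2)) (q.1, p.2)
    simp only [Matrix.sum_apply, kroneckerMap_apply, transpose_apply] at this ⊢
    rw [← this]
    rfl
  rw [this]
  exact posSemidef_sum _ fun i _ => (hA i).kronecker (hB i).transpose

/-- The singlet `φ` is an eigenvector, with eigenvalue `-1`, of the partial transpose of `ψψ*`. -/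
theorem neg_one_le_of_isKPositive_holevoWerner {m d : ℕ} {lam : ℝ} (hm : 2 ≤ m) (hd : 2 ≤ d)
    (h : IsKPositive m (holevoWerner d lam)) : -1 ≤ lam := by
  let i₀ : Fin m := ⟨0, by omega⟩
  let i₁ : Fin m := ⟨1, by omega⟩
  let a₀ : Fin d := ⟨0, by omega⟩
  let a₁ : Fin d := ⟨1, by omega⟩
  have hi : i₀ ≠ i₁ := by simp [i₀, i₁]
  have ha : a₀ ≠ a₁ := by simp [a₀, a₁]
  let ψ : Fin m × Fin d → ℂ := Pi.single (i₀, a₀) 1 + Pi.single (i₁, a₁) 1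
  let φ : Fin m × Fin d → ℂ := Pi.single (i₀, a₁) 1 - Pi.single (i₁, a₀) 1
  have hpos := (h _ (posSemidef_vecMulVec_self_star ψ)).dotProduct_mulVec_nonneg φ
  have hval : star φ ⬝ᵥ (idTensor m (holevoWerner d lam) (vecMulVec ψ (star ψ)) *ᵥ φ) =
      ((2 * (1 + lam) : ℝ) : ℂ) := by
    have hexp (M : Matrix (Fin m × Fin d) (Fin m × Fin d) ℂ) : star φ ⬝ᵥ (M *ᵥ φ) =
        M (i₀, a₁) (i₀, a₁) - M (i₀, a₁) (i₁, a₀) - M (i₁, a₀) (i₀, a₁)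
          + M (i₁, a₀) (i₁, a₀) := by
      simp only [φ, mulVec_sub, star_sub, Pi.star_single, star_one, sub_dotProduct,
        single_dotProduct, Pi.sub_apply, mulVec_single_one, col_apply, one_mul]
      ring
    rw [hexp]
    simp only [idTensor_holevoWerner_apply, vecMulVec_apply, Pi.star_apply]
    simp [ψ, Pi.single_apply, hi, ha, hi.symm, ha.symm]
    ring
  rw [hval] at hpos
  have : (0 : ℝ) ≤ 2 * (1 + lam) := by exact_mod_cast hpos
  linarith

/-- The maximally entangled `ψ` of rank `k` is an eigenvector of its own output, with eigenvalue `1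
- λk`. -/
theorem le_inv_of_isKPositive_transposeMap_holevoWerner {k d : ℕ} {lam : ℝ} (hk : 1 ≤ k)
    (hkd : k ≤ d) (h : IsKPositive k (transposeMap d ∘ₗ holevoWerner d lam)) : lam ≤ 1 / k := by
  let ψ : Fin k × Fin d → ℂ := fun p => if Fin.castLE hkd p.1 = p.2 then 1 else 0
  have hpos := (h _ (posSemidef_vecMulVec_self_star ψ)).dotProduct_mulVec_nonneg ψ
  have hstar (p) : star (ψ p) = ψ p := by simp [ψ, apply_ite]
  have hent (p q : Fin k × Fin d) : idTensor k (transposeMap d ∘ₗ holevoWerner d lam)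
      (vecMulVec ψ (star ψ)) p q = (if p = q then 1 else 0) - lam * (ψ p * ψ q) := by
    have : idTensor k (transposeMap d ∘ₗ holevoWerner d lam) (vecMulVec ψ (star ψ)) p q =
      idTensor k (holevoWerner d lam) (vecMulVec ψ (star ψ)) (p.1, q.2) (q.1, p.2) := rfl
    rw [this, idTensor_holevoWerner_apply]
    simp only [vecMulVec_apply, Pi.star_apply, hstar]
    have hsum' : ∑ c, ψ (p.1, c) * ψ (q.1, c) = if p.1 = q.1 then 1 else 0 := by
      simp [ψ, eq_comm]
    rw [hsum', one_apply]
    obtain ⟨i, a⟩ := p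
    obtain ⟨j, b⟩ := q
    by_cases hij : i = j <;> by_cases hab : a = b <;> simp [hij, hab, eq_comm (a := b)]
  have hsum : ∑ p, ψ p * ψ p = k := by
    simp [ψ, Fintype.sum_prod_type]
  have hval : star ψ ⬝ᵥ (idTensor k (transposeMap d ∘ₗ holevoWerner d lam)
      (vecMulVec ψ (star ψ)) *ᵥ ψ) = ((k - lam * (k * k) : ℝ) : ℂ) := by
    have hmul (p) : (idTensor k (transposeMap d ∘ₗ holevoWerner d lam)
      (vecMulVec ψ (star ψ)) *ᵥ ψ) p = (1 - lam * k) * ψ p := by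
      simp only [mulVec, dotProduct, hent, sub_mul, Finset.sum_sub_distrib, ite_mul, one_mul,
        zero_mul, Finset.sum_ite_eq, Finset.mem_univ, if_true]
      rw [← hsum, Finset.mul_sum, Finset.sum_mul]
      congr 1
      exact Finset.sum_congr rfl fun q _ => by ring
    simp only [dotProduct, hmul, Pi.star_apply, hstar]
    have : ∑ p, ψ p * ((1 - lam * k) * ψ p) = (1 - lam * k) * ∑ p, ψ p * ψ p := by
      rw [Finset.mul_sum]
      exact Finset.sum_congr rfl fun q _ => by ring
    rw [this, hsum]
    push_cast
    ring
  rw [hval] at hpos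
  have h1 : (0 : ℝ) ≤ k - lam * (k * k) := by exact_mod_cast hpos
  have hk0 : (0 : ℝ) < k := by exact_mod_cast hk
  rw [le_div_iff₀ hk0]
  nlinarith

theorem mainTheorem8 (k d : ℕ) (hk : 1 ≤ k) (hkd : k ≤ d) (lam : ℝ) :
    -- the three conditions are equivalent as soon as `2 ≤ k`
    (2 ≤ k → List.TFAE
      [IsCPMap (holevoWerner d lam) ∧ IsKEB k (holevoWerner d lam),
       IsKPPT k (holevoWerner d lam),
       lam ∈ Set.Icc (-1 : ℝ) (1 / (k : ℝ))]) ∧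
    -- the first and the third are equivalent also for `k = 1`, provided that `2 ≤ d`
    (2 ≤ d →
      ((IsCPMap (holevoWerner d lam) ∧ IsKEB k (holevoWerner d lam)) ↔
        lam ∈ Set.Icc (-1 : ℝ) (1 / (k : ℝ)))) ∧
    -- two implications hold for all `1 ≤ k ≤ d`
    (lam ∈ Set.Icc (-1 : ℝ) (1 / (k : ℝ)) →
      IsCPMap (holevoWerner d lam) ∧ IsKEB k (holevoWerner d lam)) ∧
    (IsCPMap (holevoWerner d lam) ∧ IsKEB k (holevoWerner d lam) →
      IsKPPT k (holevoWerner d lam)) := by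
  have h31 : lam ∈ Set.Icc (-1 : ℝ) (1 / (k : ℝ)) →
      IsCPMap (holevoWerner d lam) ∧ IsKEB k (holevoWerner d lam) := by
    intro hl
    have hk1 : 1 / (k : ℝ) ≤ 1 := by
      rw [div_le_one (by exact_mod_cast hk)]
      exact_mod_cast hk
    have hcp : IsCPMap (holevoWerner d lam) := isCPMap_holevoWerner ⟨hl.1, hl.2.trans hk1⟩
    exact ⟨hcp, hcp k hk, fun X hX => isSeparableMatrix_holevoWerner hk hl hX⟩
  have h12 : IsCPMap (holevoWerner d lam) ∧ IsKEB k (holevoWerner d lam) →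
      IsKPPT k (holevoWerner d lam) := fun h => h.2.isKPPT
  have hup (h : IsKPPT k (holevoWerner d lam)) : lam ≤ 1 / k :=
    le_inv_of_isKPositive_transposeMap_holevoWerner hk hkd h.2
  refine ⟨fun hk2 => ?_, fun hd2 => ⟨fun h => ⟨?_, hup (h12 h)⟩, h31⟩, h31, h12⟩
  · tfae_have 1 → 2 := h12
    tfae_have 2 → 3 := fun h =>
      ⟨neg_one_le_of_isKPositive_holevoWerner hk2 (hk2.trans hkd) h.1, hup h⟩
    tfae_have 3 → 1 := h31
    tfae_finish
  -- For `k = 1` positivity gives no lower bound on `λ`, so 2-positivity is taken from complete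
  -- positivity.
  · exact neg_one_le_of_isKPositive_holevoWerner le_rfl hd2 (h.1 2 one_le_two)
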